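/- Let $\mathfrak B$ be an infinite-dimensional, separable, unital $C^*$-algebra that is simple (its only norm-closed two-sided ideals are $\{0\}$ and $\mathfrak B$), and let $\pi:\mathfrak B\to\mathcal B(\mathcal H)$ be any unital $*$-representation on a complex Hilbert space $\mathcal H$. Then the von Neumann algebra $M=\pi(\mathfrak B)''$ has no type $\mathrm{I}_{\mathrm{fin}}$ component; that is, there is no nonzero projection $E$ in the center of $M$ such that the direct summand $ME$ is a finite von Neumann algebra of type $\mathrm I$. Here $ME$ is finite if every $v\in M$ such that $v^*v=E$ and $vv^*$ is a projection with $vv^*\le E$ satisfies $vv^*=E$; and $ME$ is of type $\mathrm I$ if for every nonzero central projection $F\le E$ of $M$ there is a nonzero projection $e\in M$, $e\le F$, such that $eMe$ is commutative. -/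

import Mathlib

/-- A (unital) C⋆-algebra is *simple* if it is nonzero and its only norm-closed two-sided ideals
are the zero ideal and the whole algebra. -/
def IsSimpleCStarAlgebra (B : Type*) [CStarAlgebra B] : Prop :=
  Nontrivial B ∧
    ∀ I : TwoSidedIdeal B, IsClosed {x : B | x ∈ I} → I = ⊥ ∨ I = ⊤

section Bicommutant

variable {B H : Type*} [CStarAlgebra B] [NormedAddCommGroup H] [InnerProductSpace ℂ H]
  [CompleteSpace H]

/-- The von Neumann algebra `π(B)''` generated by a (unital) representation `π` of `B` on the
Hilbert space `H`: the double commutant of the range of `π`. -/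
noncomputable def bicommutant (π : B →⋆ₐ[ℂ] (H →L[ℂ] H)) : VonNeumannAlgebra H where
  toStarSubalgebra :=
    StarSubalgebra.centralizer ℂ
      (StarSubalgebra.centralizer ℂ (Set.range π) : Set (H →L[ℂ] H))
  centralizer_centralizer' := by simp

theorem coe_bicommutant (π : B →⋆ₐ[ℂ] (H →L[ℂ] H)) :
    (bicommutant π : Set (H →L[ℂ] H)) = Set.centralizer (Set.centralizer (Set.range π)) := by
  have h : star (Set.range π) = Set.range π := by
    ext x
    constructor
    · rintro ⟨b, hb⟩
      exact ⟨star b, by rw [map_star, hb, star_star]⟩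
    · rintro ⟨b, rfl⟩
      exact ⟨star b, map_star π b⟩
  exact (StarSubalgebra.coe_centralizer_centralizer ℂ (Set.range π)).trans (by rw [h, Set.union_self])

end Bicommutant

namespace VonNeumannAlgebra

variable {H : Type*} [NormedAddCommGroup H] [InnerProductSpace ℂ H] [CompleteSpace H]

/-- `E` is an (orthogonal) projection belonging to the von Neumann algebra `M`. -/
def IsProj (M : VonNeumannAlgebra H) (E : H →L[ℂ] H) : Prop :=
  E ∈ M ∧ IsStarProjection E

/-- `E` is a projection in the center `M ∩ M'` of `M`. -/
def IsCentralProj (M : VonNeumannAlgebra H) (E : H →L[ℂ] H) : Prop :=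
  M.IsProj E ∧ E ∈ M.commutant

/-- `e` is an abelian projection of `M`: a projection in `M` such that the algebra `e M e` is
commutative. -/
def IsAbelianProj (M : VonNeumannAlgebra H) (e : H →L[ℂ] H) : Prop :=
  M.IsProj e ∧ ∀ x ∈ M, ∀ y ∈ M, (e * x * e) * (e * y * e) = (e * y * e) * (e * x * e)

/-- `E` is a finite projection of `M`: a projection in `M` that is not Murray-von Neumann
equivalent in `M` to a proper subprojection of itself. (The equation `E * (v * star v) = v * star v`
says that the projection `v * star v` is a subprojection of `E`.) -/
def IsFiniteProj (M : VonNeumannAlgebra H) (E : H →L[ℂ] H) : Prop :=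
  M.IsProj E ∧
    ∀ v ∈ M, star v * v = E → E * (v * star v) = v * star v → v * star v = E

/-- For a central projection `E` of `M`, the direct summand `M E` is a von Neumann algebra of
type I: each nonzero central projection `F ≤ E` dominates a nonzero abelian projection.
(The central projections of `M E` are the central projections of `M` that lie below `E`, and for
projections `e ≤ F` means `F * e = e`.) -/
def IsTypeICentralProj (M : VonNeumannAlgebra H) (E : H →L[ℂ] H) : Prop :=
  M.IsCentralProj E ∧
    ∀ F, M.IsCentralProj F → E * F = F → F ≠ 0 → ∃ e, M.IsAbelianProj e ∧ F * e = e ∧ e ≠ 0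

/-- `M` contains a type `I_fin` component: there is a nonzero central projection `E` of `M` such
that the direct summand `M E` is finite and of type I. -/
def ContainsTypeIFin (M : VonNeumannAlgebra H) : Prop :=
  ∃ E : H →L[ℂ] H, E ≠ 0 ∧ M.IsTypeICentralProj E ∧ M.IsFiniteProj E

end VonNeumannAlgebra

/-! A finite type I summand bounds the order of nilpotents, while an infinite-dimensional simple
C⋆-algebra has nilpotents of arbitrarily high order.

Upper bound: let `e ≤ E` be a nonzero abelian projection. Finiteness of `E` makes a maximal family
of orthogonal copies of `e` below `E` finite (`IsFiniteProj.false_of_sequence`). By comparison with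
the remainder of `E`, some nonzero projection `r ≤ e` satisfies `(∑ v v*) m r = m r` for all `m ∈ M`
(`IsAbelianProj.exists_finset_sum_mul`). The action of `M` on `M r` is then given by matrices of
fixed size over a commutative reduced ring, so Cayley–Hamilton bounds the nilpotency order there
(`IsAbelianProj.pow_mul_mul_eq_zero`). The elements `b` with `π b` annihilating `M r` form a proper
closed ideal, hence zero, and the bound passes to `B`.

Lower bound: if orthogonal families of selfadjoint elements had bounded size, a largest one would
rescale to minimal projections with sum one, forcing finite dimension. Otherwise primeness links the
members of a long orthogonal family into a weighted shift, a nilpotent of high order. -/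

/-! ### Primeness, functional calculus and nilpotents -/

theorem IsSimpleCStarAlgebra.mem_of_isClosed_ideal {B : Type*} [CStarAlgebra B]
    (hB : IsSimpleCStarAlgebra B) (S : Set B) (hc : IsClosed S) (h0 : (0 : B) ∈ S)
    (hadd : ∀ x ∈ S, ∀ y ∈ S, x + y ∈ S) (hmul : ∀ x ∈ S, ∀ c d, c * x * d ∈ S)
    (h1 : (1 : B) ∉ S) : ∀ x ∈ S, x = 0 := by
  let I : TwoSidedIdeal B := TwoSidedIdeal.mk' S h0 (fun {x y} hx hy => hadd x hx y hy)
    (fun {x} hx => by simpa using hmul x hx (-1) 1)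
    (fun {x y} hy => by simpa using hmul y hy x 1)
    (fun {x y} hx => by simpa using hmul x hx 1 y)
  have hI : ∀ x, x ∈ I ↔ x ∈ S := fun x => by simp [I]
  rcases hB.2 I (by simpa [hI] using hc) with h | h
  · intro x hx
    have := (hI x).2 hx
    rw [h] at this
    simpa using this
  · exact absurd ((hI 1).1 (h ▸ trivial)) h1

/-- Primeness: the right annihilator of `x B` is a closed two-sided ideal, and it omits `1` because
`x ≠ 0`. -/
theorem IsSimpleCStarAlgebra.exists_mul_mul_ne_zero {B : Type*} [CStarAlgebra B]
    (hB : IsSimpleCStarAlgebra B) {x y : B} (hx : x ≠ 0) (hy : y ≠ 0) : ∃ b, x * b * y ≠ 0 := by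
  by_contra! h
  refine hy (hB.mem_of_isClosed_ideal {z | ∀ b, x * b * z = 0} ?_ (by simp) ?_ ?_ ?_ y h)
  · simp only [Set.ofPred_forall]
    exact isClosed_iInter fun b => isClosed_eq (by fun_prop) (by fun_prop)
  · intro z hz w hw b
    rw [mul_add, hz, hw, add_zero]
  · intro z hz c d b
    have := hz (b * c)
    rw [show x * b * (c * z * d) = (x * (b * c) * z) * d by noncomm_ring, this, zero_mul]
  · intro h1
    exact hx (by simpa using h1 1)

/-- If there are no two orthogonal nonzero selfadjoint multiples of the selfadjoint element `x`, then `x ^ 2` is a multiple of `x`. -/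
theorem IsSelfAdjoint.exists_mul_self_eq_smul {B : Type*} [CStarAlgebra B] {x : B}
    (hx : IsSelfAdjoint x)
    (h : ∀ g₁ g₂ : B, IsSelfAdjoint (x * g₁) → IsSelfAdjoint (x * g₂) → x * g₁ = g₁ * x →
      x * g₂ = g₂ * x → x * g₁ * (x * g₂) = 0 → x * g₁ = 0 ∨ x * g₂ = 0) :
    ∃ μ : ℝ, x * x = μ • x := by
  by_cases h2 : ∃ l ∈ spectrum ℝ x, ∃ m ∈ spectrum ℝ x, l ≠ 0 ∧ m ≠ 0 ∧ l ≠ m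
  · exfalso
    obtain ⟨l, hl, m, hm, hl0, hm0, hlm⟩ := h2
    -- A tent around `c` of half-width `|l - m| / 2`, so that the tents at `l` and `m` have product
    -- zero.
    let f : ℝ → ℝ → ℝ := fun c t => max 0 (|l - m| / 2 - |t - c|)
    have hf : ∀ c, Continuous (f c) := fun c => by fun_prop
    have hmul : ∀ c, x * cfc (f c) x = cfc (fun t => t * f c t) x := fun c => by
      rw [cfc_mul (fun t => t) (f c) x (by fun_prop) (hf c).continuousOn, cfc_id' ℝ x]
    have hmul' : ∀ c, cfc (f c) x * x = cfc (fun t => t * f c t) x := fun c => by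
      have := (cfc_commute_cfc (fun t : ℝ => t) (f c) x).eq
      rw [cfc_id' ℝ x] at this
      rw [← this, hmul]
    have hsa : ∀ c, IsSelfAdjoint (x * cfc (f c) x) := fun c => by
      rw [hmul]; exact cfc_predicate _ _
    have hne : ∀ c ∈ spectrum ℝ x, c ≠ 0 → x * cfc (f c) x ≠ 0 := by
      intro c hc hc0 h0
      rw [hmul] at h0
      have : c * f c c ∈ spectrum ℝ (cfc (fun t => t * f c t) x) := by
        rw [cfc_map_spectrum _ x hx (by fun_prop)]
        exact ⟨c, hc, rfl⟩
      rw [h0] at this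
      have hnt : Nontrivial B := by
        by_contra hB
        rw [not_nontrivial_iff_subsingleton] at hB
        simp [spectrum.of_subsingleton] at hc
      rw [spectrum.zero_eq] at this
      have hlm' : 0 < |l - m| := abs_pos.2 (sub_ne_zero.2 hlm)
      simp only [f, sub_self, abs_zero, sub_zero, Set.mem_singleton_iff, mul_eq_zero, hc0,
        false_or, max_eq_left_iff] at this
      linarith
    have horth : x * cfc (f l) x * (x * cfc (f m) x) = 0 := by
      rw [hmul, hmul, ← cfc_mul _ _ x (by fun_prop) (by fun_prop)]
      have hzero : ∀ t, t * f l t * (t * f m t) = 0 := by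
        intro t
        have htri := abs_sub_le l t m
        rw [abs_sub_comm l t] at htri
        rcases le_total (|l - m| / 2) |t - l| with h1 | h1
        · simp [f, max_eq_left (sub_nonpos.2 h1)]
        · have h2 : |l - m| / 2 ≤ |t - m| := by linarith
          simp [f, max_eq_left (sub_nonpos.2 h2)]
      simp_rw [hzero]
      exact cfc_const_zero ℝ x
    rcases h (cfc (f l) x) (cfc (f m) x) (hsa _) (hsa _) ((hmul _).trans (hmul' _).symm)
      ((hmul _).trans (hmul' _).symm) horth with h | h
    · exact hne l hl hl0 h
    · exact hne m hm hm0 h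
  · push Not at h2
    obtain ⟨μ, hμ⟩ : ∃ μ : ℝ, ∀ t ∈ spectrum ℝ x, t * t = μ * t := by
      by_cases h3 : ∃ l ∈ spectrum ℝ x, l ≠ 0
      · obtain ⟨l, hl, hl0⟩ := h3
        refine ⟨l, fun t ht => ?_⟩
        by_cases ht0 : t = 0
        · simp [ht0]
        · rw [h2 l hl t ht hl0 ht0]
      · push Not at h3
        exact ⟨0, fun t ht => by simp [h3 t ht]⟩
    refine ⟨μ, ?_⟩
    calc x * x = cfc (fun t : ℝ => t * t) x := by
          rw [cfc_mul (fun t => t) (fun t => t) x (by fun_prop) (by fun_prop), cfc_id' ℝ x]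
      _ = cfc (fun t : ℝ => μ * t) x := cfc_congr hμ
      _ = μ • x := by rw [cfc_const_mul_id μ x]

/-- The element is a shift `∑ a i * b i * a (i + 1)`: by orthogonality its powers only follow
increasing paths, and primeness supplies `b i` that keep the longest path nonzero. -/
theorem exists_isNilpotent_pow_ne_zero {B : Type*} [Ring B]
    (hp : ∀ x y : B, x ≠ 0 → y ≠ 0 → ∃ b, x * b * y ≠ 0) (n : ℕ) (a : ℕ → B)
    (ha : ∀ i j, i ≠ j → a i * a j = 0) (ha0 : ∀ i ≤ n, a i * a i ≠ 0) :
    ∃ x : B, IsNilpotent x ∧ x ^ n ≠ 0 := by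
  -- The clause `x ^ k * a k ≠ 0` lets the path be prolonged. The two vanishing clauses make the new
  -- link `y` satisfy `y * x = 0` and keep the path increasing.
  have key : ∀ k ≤ n, ∃ x : B, x ^ (k + 1) = 0 ∧ x ^ k * a k ≠ 0 ∧ (∀ j, k < j → x * a j = 0) ∧
      ∀ j, k ≤ j → a j * x = 0 := by
    intro k
    induction k with
    | zero =>
      intro _
      refine ⟨0, by simp, ?_, by simp, by simp⟩
      intro h
      exact ha0 0 (Nat.zero_le _) (by simp_all)
    | succ k ih =>
      intro hk
      obtain ⟨x, hx0, hx1, hx2, hx3⟩ := ih (by omega)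
      -- The square of `a (k + 1)` leaves one factor for the link and one for the next nonvanishing
      -- clause.
      obtain ⟨b, hb⟩ := hp _ _ hx1 (ha0 (k + 1) hk)
      set y := a k * b * a (k + 1) with hy
      have hyx : y * x = 0 := by rw [hy, mul_assoc, hx3 _ (by omega), mul_zero]
      have hyy : y * y = 0 := by
        rw [hy, show a k * b * a (k + 1) * (a k * b * a (k + 1)) =
          a k * b * (a (k + 1) * a k) * b * a (k + 1) by noncomm_ring, ha _ _ (by omega)]
        simp
      have hpow : ∀ m, (x + y) ^ (m + 1) = x ^ (m + 1) + x ^ m * y := by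
        intro m
        induction m with
        | zero => simp
        | succ m ihm =>
          rw [pow_succ, ihm, add_mul, mul_add, mul_add, mul_assoc _ y x, mul_assoc _ y y, hyx, hyy,
            ← pow_succ]
          simp
      refine ⟨x + y, ?_, ?_, ?_, ?_⟩
      · rw [hpow, pow_succ, hx0]; simp
      · rw [hpow, hx0, zero_add, hy]
        intro h
        apply hb
        rw [← h]; noncomm_ring
      · intro j hj
        rw [add_mul, hx2 j (by omega), hy, mul_assoc, ha _ _ (by omega)]; simp
      · intro j hj
        rw [mul_add, hx3 j (by omega), hy, ← mul_assoc, ← mul_assoc, ha _ _ (by omega)]; simp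
  obtain ⟨x, h0, h1, -⟩ := key n le_rfl
  exact ⟨x, ⟨_, h0⟩, fun h => h1 (by rw [h, zero_mul])⟩

/-! ### Orthogonal families and finite dimensionality -/

section OrthogonalFamilies

variable {B : Type*} [CStarAlgebra B]

/-- A finite set of pairwise orthogonal nonzero selfadjoint elements. -/
def IsOrthogonalFinset (s : Finset B) : Prop :=
  (∀ a ∈ s, IsSelfAdjoint a ∧ a ≠ 0) ∧ ∀ a ∈ s, ∀ b ∈ s, a ≠ b → a * b = 0

theorem IsSelfAdjoint.mul_self_ne_zero {a : B} (ha : IsSelfAdjoint a) (h : a ≠ 0) : a * a ≠ 0 := by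
  intro h0
  apply h
  rw [← CStarRing.star_mul_self_eq_zero_iff, ha.star_eq, h0]

/-- If orthogonal finsets have bounded size, there are finitely many minimal projections that add up
to one. -/
theorem exists_minimal_projections {N : ℕ}
    (hN : ∀ s : Finset B, IsOrthogonalFinset s → s.card ≤ N) :
    ∃ s : Finset B, (∀ p ∈ s, IsStarProjection p) ∧ ∑ p ∈ s, p = 1 ∧
      ∀ p ∈ s, ∀ x, ∃ c : ℂ, p * x * p = c • p := by
  classical
  -- a finset of maximal cardinality
  obtain ⟨s, hs, hmax⟩ : ∃ s : Finset B, IsOrthogonalFinset s ∧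
      ∀ t, IsOrthogonalFinset t → t.card ≤ s.card := by
    have hne : ({k | ∃ s : Finset B, IsOrthogonalFinset s ∧ s.card = k} : Set ℕ).Nonempty :=
      ⟨0, ∅, by simp [IsOrthogonalFinset], rfl⟩
    have hbd : BddAbove {k | ∃ s : Finset B, IsOrthogonalFinset s ∧ s.card = k} :=
      ⟨N, by rintro _ ⟨s, hs, rfl⟩; exact hN s hs⟩
    obtain ⟨s, hs, hk⟩ := Nat.sSup_mem hne hbd
    exact ⟨s, hs, fun t ht => hk ▸ le_csSup hbd ⟨t, ht, rfl⟩⟩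
  -- `K a` is the two-sided annihilator of `s \ {a}`. Two orthogonal nonzero selfadjoint elements of
  -- `K a` could replace `a` and enlarge `s`, against maximality.
  let K : B → Set B := fun a => {x | ∀ b ∈ s, b ≠ a → x * b = 0 ∧ b * x = 0}
  have hKself : ∀ a ∈ s, a ∈ K a := fun a ha b hb hba =>
    ⟨hs.2 a ha b hb hba.symm, hs.2 b hb a ha hba⟩
  have hKmul : ∀ a, ∀ x ∈ K a, ∀ y z, y ∈ K a → x * z * y ∈ K a := fun a x hx y z hy b hb hba =>
    ⟨by rw [mul_assoc, (hy b hb hba).1, mul_zero],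
      by rw [← mul_assoc, ← mul_assoc, (hx b hb hba).2, zero_mul, zero_mul]⟩
  have hKsub : ∀ a, ∀ x ∈ K a, ∀ y ∈ K a, x - y ∈ K a := fun a x hx y hy b hb hba =>
    ⟨by rw [sub_mul, (hx b hb hba).1, (hy b hb hba).1, sub_zero],
      by rw [mul_sub, (hx b hb hba).2, (hy b hb hba).2, sub_zero]⟩
  have hKsmul : ∀ a, ∀ x ∈ K a, ∀ c : ℝ, c • x ∈ K a := fun a x hx c b hb hba =>
    ⟨by rw [smul_mul_assoc, (hx b hb hba).1, smul_zero],
      by rw [mul_smul_comm, (hx b hb hba).2, smul_zero]⟩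
  -- no splitting
  have hsplit : ∀ a ∈ s, ∀ u ∈ K a, ∀ v ∈ K a, IsSelfAdjoint u → IsSelfAdjoint v → u * v = 0 →
      u = 0 ∨ v = 0 := by
    intro a ha u hu v hv hus hvs huv
    by_contra! h0
    have hvu : v * u = 0 := by
      have := congrArg star huv
      rwa [star_mul, hus.star_eq, hvs.star_eq, star_zero] at this
    have hne : u ≠ v := by
      rintro rfl
      exact hus.mul_self_ne_zero h0.1 huv
    have hnot : ∀ x ∈ K a, IsSelfAdjoint x → x ≠ 0 → x ∉ s.erase a := by
      intro x hx hxs hx0 hmem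
      rw [Finset.mem_erase] at hmem
      exact hxs.mul_self_ne_zero hx0 (hx x hmem.2 hmem.1).1
    have hu' : u ∉ insert v (s.erase a) := by
      simp only [Finset.mem_insert, not_or]
      exact ⟨hne, hnot u hu hus h0.1⟩
    have := hmax (insert u (insert v (s.erase a))) ?_
    · rw [Finset.card_insert_of_notMem hu', Finset.card_insert_of_notMem (hnot v hv hvs h0.2),
        Finset.card_erase_of_mem ha] at this
      have := Finset.card_pos.2 ⟨a, ha⟩
      omega
    · have h1 : ∀ x ∈ s.erase a, x ∈ s ∧ x ≠ a := fun x hx => (Finset.mem_erase.1 hx).symm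
      constructor
      · intro x hx
        rcases Finset.mem_insert.1 hx with rfl | hx
        · exact ⟨hus, h0.1⟩
        rcases Finset.mem_insert.1 hx with rfl | hx
        · exact ⟨hvs, h0.2⟩
        exact hs.1 x (h1 x hx).1
      · intro x hx y hy hxy
        rcases Finset.mem_insert.1 hx with hxu | hx' <;>
          rcases Finset.mem_insert.1 hy with hyu | hy'
        · exact absurd (hxu.trans hyu.symm) hxy
        · rw [hxu]
          rcases Finset.mem_insert.1 hy' with hyv | hy'
          · rw [hyv, huv]
          · exact (hu y (h1 y hy').1 (h1 y hy').2).1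
        · rw [hyu]
          rcases Finset.mem_insert.1 hx' with hxv | hx'
          · rw [hxv, hvu]
          · exact (hu x (h1 x hx').1 (h1 x hx').2).2
        · rcases Finset.mem_insert.1 hx' with hxv | hx' <;>
            rcases Finset.mem_insert.1 hy' with hyv | hy'
          · exact absurd (hxv.trans hyv.symm) hxy
          · rw [hxv]
            exact (hv y (h1 y hy').1 (h1 y hy').2).1
          · rw [hyv]
            exact (hv x (h1 x hx').1 (h1 x hx').2).2
          · exact hs.2 x (h1 x hx').1 y (h1 y hy').1 hxy
  have hquad : ∀ a ∈ s, ∀ x ∈ K a, IsSelfAdjoint x → x ≠ 0 → ∃ μ : ℝ, μ ≠ 0 ∧ x * x = μ • x := by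
    intro a ha x hx hxs hx0
    obtain ⟨μ, hμ⟩ := hxs.exists_mul_self_eq_smul (fun g₁ g₂ h₁ h₂ h₁' h₂' h => by
      refine hsplit a ha _ ?_ _ ?_ h₁ h₂ h
      · intro b hb hba
        refine ⟨by rw [h₁', mul_assoc, (hx b hb hba).1, mul_zero],
          by rw [← mul_assoc, (hx b hb hba).2, zero_mul]⟩
      · intro b hb hba
        refine ⟨by rw [h₂', mul_assoc, (hx b hb hba).1, mul_zero],
          by rw [← mul_assoc, (hx b hb hba).2, zero_mul]⟩)
    refine ⟨μ, ?_, hμ⟩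
    rintro rfl
    exact hxs.mul_self_ne_zero hx0 (by simpa using hμ)
  -- rescaling to a projection
  have hproj : ∀ a ∈ s, ∀ x ∈ K a, IsSelfAdjoint x → x ≠ 0 →
      ∃ μ : ℝ, μ ≠ 0 ∧ IsStarProjection (μ • x) := by
    intro a ha x hx hxs hx0
    obtain ⟨μ, hμ, hxx⟩ := hquad a ha x hx hxs hx0
    refine ⟨μ⁻¹, inv_ne_zero hμ, ?_, ?_⟩
    · rw [IsIdempotentElem, smul_mul_smul_comm, hxx, smul_smul, mul_assoc, inv_mul_cancel₀ hμ,
        mul_one]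
    · exact IsSelfAdjoint.smul (IsSelfAdjoint.all _) hxs
  choose! lam hlam0 hlam using fun a (ha : a ∈ s) =>
    hproj a ha a (hKself a ha) (hs.1 a ha).1 (hs.1 a ha).2
  let p : B → B := fun a => lam a • a
  have hpK : ∀ a ∈ s, p a ∈ K a := fun a ha => hKsmul a a (hKself a ha) _
  have hp0 : ∀ a ∈ s, p a ≠ 0 := fun a ha => smul_ne_zero (hlam0 a ha) (hs.1 a ha).2
  have hpp : ∀ a ∈ s, ∀ b ∈ s, a ≠ b → p a * p b = 0 := fun a ha b hb hab => by
    simp only [p, smul_mul_smul_comm, hs.2 a ha b hb hab, smul_zero]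
  -- A nonzero `x` rescales to a projection `q` below `p a`; since `q` and `p a - q` are orthogonal
  -- in `K a`, they cannot both be nonzero.
  have hscal : ∀ a ∈ s, ∀ x, p a * x * p a = x → IsSelfAdjoint x → ∃ c : ℝ, x = c • p a := by
    intro a ha x hx hxs
    by_cases hx0 : x = 0
    · exact ⟨0, by simp [hx0]⟩
    have hxK : x ∈ K a := hx ▸ hKmul a _ (hpK a ha) _ _ (hpK a ha)
    obtain ⟨μ, hμ, hq⟩ := hproj a ha x hxK hxs hx0
    have hpi := (hlam a ha).isIdempotentElem.eq
    have h1 : μ • x * p a = μ • x := by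
      rw [← hx]; simp only [smul_mul_assoc, mul_assoc]; rw [hpi]
    rcases hsplit a ha (μ • x) (hKsmul a x hxK μ) (p a - μ • x)
      (hKsub a _ (hpK a ha) _ (hKsmul a x hxK μ)) hq.isSelfAdjoint
      ((hlam a ha).isSelfAdjoint.sub hq.isSelfAdjoint)
      (by rw [mul_sub, h1, hq.isIdempotentElem.eq, sub_self]) with h | h
    · exact absurd h (smul_ne_zero hμ hx0)
    · refine ⟨μ⁻¹, ?_⟩
      rw [sub_eq_zero.1 h, smul_smul, inv_mul_cancel₀ hμ, one_smul]
  have hinj : Set.InjOn p s := fun a ha b hb hab => by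
    by_contra hne
    have := hpp a ha b hb hne
    rw [← hab] at this
    exact (hlam a ha).isSelfAdjoint.mul_self_ne_zero (hp0 a ha) this
  refine ⟨s.image p, ?_, ?_, ?_⟩
  · simp only [Finset.forall_mem_image]
    exact fun a ha => hlam a ha
  · rw [Finset.sum_image hinj]
    set e := ∑ a ∈ s, p a with he
    have hesa : IsSelfAdjoint e := by
      rw [he, IsSelfAdjoint, star_sum]
      exact Finset.sum_congr rfl fun a ha => (hlam a ha).isSelfAdjoint.star_eq
    have hep : ∀ a ∈ s, e * p a = p a := fun a ha => by
      rw [he, Finset.sum_mul, Finset.sum_eq_single_of_mem a ha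
        (fun b hb hba => hpp b hb a ha hba)]
      exact (hlam a ha).isIdempotentElem.eq
    have hea : ∀ a ∈ s, (1 - e) * a = 0 := fun a ha => by
      have : a = (lam a)⁻¹ • p a := by simp [p, smul_smul, inv_mul_cancel₀ (hlam0 a ha)]
      rw [this, mul_smul_comm, sub_mul, one_mul, hep a ha, sub_self, smul_zero]
    have hsa1 : IsSelfAdjoint (1 - e) := (IsSelfAdjoint.one B).sub hesa
    have hae : ∀ a ∈ s, a * (1 - e) = 0 := fun a ha => by
      have := congrArg star (hea a ha)
      rwa [star_mul, hsa1.star_eq, (hs.1 a ha).1.star_eq, star_zero] at this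
    -- Otherwise `1 - e`, being orthogonal to all of `s`, could be added to it.
    by_contra hne
    have h0 : 1 - e ≠ 0 := fun h => hne (sub_eq_zero.1 h).symm
    have hnot : 1 - e ∉ s := fun h => hsa1.mul_self_ne_zero h0 (hea _ h)
    have := hmax (insert (1 - e) s) ⟨?_, ?_⟩
    · rw [Finset.card_insert_of_notMem hnot] at this
      omega
    · intro x hx
      rcases Finset.mem_insert.1 hx with rfl | hx
      · exact ⟨hsa1, h0⟩
      · exact hs.1 x hx
    · intro x hx y hy hxy
      rcases Finset.mem_insert.1 hx with rfl | hx <;> rcases Finset.mem_insert.1 hy with rfl | hy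
      · exact absurd rfl hxy
      · exact hea y hy
      · exact hae x hx
      · exact hs.2 x hx y hy hxy
  · simp only [Finset.forall_mem_image]
    intro a ha x
    have hpi := (hlam a ha).isIdempotentElem.eq
    have hps := (hlam a ha).isSelfAdjoint
    have hcor : ∀ y : B, p a * (p a * y * p a) * p a = p a * y * p a := fun y => by
      rw [← mul_assoc, ← mul_assoc, hpi, mul_assoc, hpi]
    have hsa : ∀ y : B, IsSelfAdjoint y → ∃ c : ℝ, p a * y * p a = c • p a := fun y hy =>
      hscal a ha _ (hcor y) (by
        rw [IsSelfAdjoint, star_mul, star_mul, hps.star_eq, hy.star_eq, mul_assoc])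
    obtain ⟨c, hc⟩ := hsa (realPart x) (realPart x).2
    obtain ⟨d, hd⟩ := hsa (imaginaryPart x) (imaginaryPart x).2
    refine ⟨c + Complex.I * d, ?_⟩
    conv_lhs => rw [← realPart_add_I_smul_imaginaryPart x]
    rw [mul_add, add_mul, hc, mul_smul_comm (Complex.I) (p a), smul_mul_assoc (Complex.I), hd,
      add_smul, mul_smul]
    simp

/-- Peirce decomposition: `B` is the sum of the corners `p B q`, each of dimension at most one by
minimality. -/
theorem finiteDimensional_of_minimal_projections (s : Finset B)
    (hs : ∀ p ∈ s, IsStarProjection p) (h1 : ∑ p ∈ s, p = 1)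
    (hmin : ∀ p ∈ s, ∀ x, ∃ c : ℂ, p * x * p = c • p) : FiniteDimensional ℂ B := by
  have hdim : ∀ p ∈ s, ∀ q ∈ s, ∃ y : B, ∀ x, ∃ c : ℂ, p * x * q = c • y := by
    intro p hp q hq
    by_cases h : ∃ z, p * z * q ≠ 0
    · obtain ⟨z, hz⟩ := h
      refine ⟨p * z * q, fun x => ?_⟩
      have hps := (hs p hp).isSelfAdjoint.star_eq
      have hqs := (hs q hq).isSelfAdjoint.star_eq
      have hpi := (hs p hp).isIdempotentElem.eq
      have hqi := (hs q hq).isIdempotentElem.eq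
      obtain ⟨c, hc⟩ := hmin q hq (star z * p * z)
      obtain ⟨d, hd⟩ := hmin p hp (x * q * star z)
      have hc' : star (p * z * q) * (p * z * q) = c • q := by
        rw [← hc, star_mul, star_mul, hps, hqs]
        calc q * (star z * p) * (p * z * q) = q * (star z * (p * p) * z) * q := by noncomm_ring
          _ = _ := by rw [hpi]
      have hc0 : c ≠ 0 := by
        rintro rfl
        rw [zero_smul, CStarRing.star_mul_self_eq_zero_iff] at hc'
        exact hz hc'
      -- Evaluate `p x q z* p z q` in two ways, using minimality of `q` and of `p`.
      have key : c • (p * x * q) = d • (p * z * q) := by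
        calc c • (p * x * q) = p * x * (c • q) := by rw [mul_smul_comm]
          _ = p * x * (q * (star z * p * z) * q) := by rw [hc]
          _ = (p * (x * q * star z) * p) * (z * q) := by noncomm_ring
          _ = d • (p * z * q) := by rw [hd, smul_mul_assoc, mul_assoc]
      refine ⟨c⁻¹ * d, ?_⟩
      rw [mul_smul, ← key, smul_smul, inv_mul_cancel₀ hc0, one_smul]
    · exact ⟨0, fun x => ⟨0, by simpa using not_exists.1 h x⟩⟩
  choose! y hy using hdim
  have : Submodule.span ℂ ((fun t : B × B => y t.1 t.2) '' (s ×ˢ s : Set (B × B))) = ⊤ := by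
    rw [eq_top_iff]
    intro x _
    have hx : x = ∑ p ∈ s, ∑ q ∈ s, p * x * q := by
      calc x = (∑ p ∈ s, p) * x * ∑ q ∈ s, q := by rw [h1, one_mul, mul_one]
        _ = _ := by simp_rw [Finset.sum_mul, Finset.mul_sum]
    rw [hx]
    refine Submodule.sum_mem _ fun p hp => Submodule.sum_mem _ fun q hq => ?_
    obtain ⟨c, hc⟩ := hy p hp q hq x
    rw [hc]
    exact Submodule.smul_mem _ _ (Submodule.subset_span ⟨(p, q), ⟨hp, hq⟩, rfl⟩)
  refine ⟨Submodule.fg_def.2 ⟨_, ?_, this⟩⟩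
  exact (s.finite_toSet.prod s.finite_toSet).image _

theorem exists_isOrthogonalFinset_lt_card (hB : ¬ FiniteDimensional ℂ B) (N : ℕ) :
    ∃ s : Finset B, IsOrthogonalFinset s ∧ N < s.card := by
  by_contra! h
  obtain ⟨s, h1, h2, h3⟩ := exists_minimal_projections h
  exact hB (finiteDimensional_of_minimal_projections s h1 h2 h3)

theorem IsSimpleCStarAlgebra.exists_isNilpotent_pow_ne_zero (hB : IsSimpleCStarAlgebra B)
    (hinf : ¬ FiniteDimensional ℂ B) (n : ℕ) : ∃ x : B, IsNilpotent x ∧ x ^ n ≠ 0 := by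
  obtain ⟨s, hs, hcard⟩ := exists_isOrthogonalFinset_lt_card hinf n
  let f := s.equivFin.symm
  let a : ℕ → B := fun i => if h : i < s.card then f ⟨i, h⟩ else 0
  refine _root_.exists_isNilpotent_pow_ne_zero (fun x y hx hy => hB.exists_mul_mul_ne_zero hx hy)
    n a ?_ ?_
  · intro i j hij
    by_cases hi : i < s.card <;> by_cases hj : j < s.card <;> simp only [a, hi, hj, dite_true,
      dite_false, mul_zero, zero_mul]
    refine hs.2 _ (f _).2 _ (f _).2 fun h => hij ?_
    simpa using f.injective (Subtype.ext h)
  · intro i hi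
    have hi' : i < s.card := by omega
    simp only [a, hi', dite_true]
    exact (hs.1 _ (f _).2).1.mul_self_ne_zero (hs.1 _ (f _).2).2

end OrthogonalFamilies

/-! ### Polar decomposition -/

namespace VonNeumannAlgebra

variable {H : Type*} [NormedAddCommGroup H] [InnerProductSpace ℂ H] [CompleteSpace H]

theorem mem_of_commute_commutant (M : VonNeumannAlgebra H) {x : H →L[ℂ] H}
    (h : ∀ y ∈ M.commutant, y * x = x * y) : x ∈ M := by
  rw [← M.commutant_commutant, mem_commutant_iff]
  exact h

theorem commute_of_mem_commutant {M : VonNeumannAlgebra H} {x y : H →L[ℂ] H} (hx : x ∈ M)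
    (hy : y ∈ M.commutant) : x * y = y * x :=
  mem_commutant_iff.1 hy x hx

theorem norm_abs_apply (x : H →L[ℂ] H) (ξ : H) : ‖CFC.abs x ξ‖ = ‖x ξ‖ := by
  have h1 : IsSelfAdjoint (CFC.abs x) := (CFC.abs_nonneg x).isSelfAdjoint
  have key : ∀ y : H →L[ℂ] H, ‖y ξ‖ ^ 2 = RCLike.re (inner ℂ ((star y * y) ξ) ξ) := fun y => by
    rw [mul_apply_eq_comp, ContinuousLinearMap.star_eq_adjoint,
      ContinuousLinearMap.adjoint_inner_left, inner_self_eq_norm_sq]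
  have : ‖CFC.abs x ξ‖ ^ 2 = ‖x ξ‖ ^ 2 := by
    rw [key, key, h1.star_eq, CFC.abs_mul_abs]
  exact (sq_eq_sq₀ (norm_nonneg _) (norm_nonneg _)).1 this

/-- Polar decomposition: the partial isometry of a nonzero element of a von Neumann algebra. -/
theorem exists_partialIsometry (M : VonNeumannAlgebra H) {x : H →L[ℂ] H} (hx : x ∈ M)
    (hx0 : x ≠ 0) :
    ∃ u ∈ M, u ≠ 0 ∧ u * star u * u = u ∧
      (∀ r : H →L[ℂ] H, x * r = x → u * r = u) ∧ ∀ p : H →L[ℂ] H, p * x = x → p * u = u := by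
  set a := CFC.abs x with ha
  have hasa : star a = a := (CFC.abs_nonneg x).isSelfAdjoint.star_eq
  set K : Submodule ℂ H := (LinearMap.range (a : H →ₗ[ℂ] H)).topologicalClosure with hK
  have hKc : IsClosed (K : Set H) := Submodule.isClosed_topologicalClosure _
  have : CompleteSpace K := hKc.completeSpace_coe
  have haK : ∀ ξ, a ξ ∈ K := fun ξ => Submodule.le_topologicalClosure _ ⟨ξ, rfl⟩
  let e : H →ₗ[ℂ] K := (a : H →ₗ[ℂ] H).codRestrict K haK
  have he : DenseRange e := by
    intro ⟨z, hz⟩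
    rw [Metric.mem_closure_iff]
    intro ε hε
    obtain ⟨_, ⟨ξ, rfl⟩, h⟩ := Metric.mem_closure_iff.1 hz ε hε
    exact ⟨e ξ, ⟨ξ, rfl⟩, h⟩
  -- Since `‖|x| ξ‖ = ‖x ξ‖`, the assignment `|x| ξ ↦ x ξ` extends to the closure of the range of
  -- `|x|`; `u` is its extension by zero.
  have hnorm : ∀ ξ, ‖x ξ‖ ≤ 1 * ‖e ξ‖ := fun ξ => by
    rw [one_mul]; exact (norm_abs_apply x ξ).ge
  let u0 : K →L[ℂ] H := (x : H →ₗ[ℂ] H).extendOfNorm e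
  have hu0 : ∀ ξ, u0 (e ξ) = x ξ := fun ξ =>
    LinearMap.extendOfNorm_eq he ⟨1, hnorm⟩ ξ
  let u : H →L[ℂ] H := u0 ∘L K.orthogonalProjectionOnto
  -- two operators that agree on the range of `a` and on its orthogonal complement are equal
  have hext : ∀ s t : H →L[ℂ] H, s * a = t * a → (∀ η ∈ Kᗮ, s η = t η) → s = t := by
    intro s t h1 h2
    have h3 : ∀ η ∈ K, s η = t η := by
      have hcl : IsClosed {η | s η = t η} := isClosed_eq s.continuous t.continuous
      have : (K : Set H) ⊆ {η | s η = t η} := by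
        refine closure_minimal ?_ hcl
        rintro _ ⟨ξ, rfl⟩
        exact DFunLike.congr_fun h1 ξ
      exact this
    ext ξ
    obtain ⟨y, hy, z, hz, rfl⟩ := K.exists_add_mem_mem_orthogonal ξ
    rw [map_add, map_add, h3 y hy, h2 z hz]
  have hua : u * a = x := by
    ext ξ
    have : K.orthogonalProjectionOnto (a ξ) = e ξ :=
      K.orthogonalProjectionOnto_mem_subspace_eq_self (e ξ)
    simp only [u, mul_apply_eq_comp, ContinuousLinearMap.comp_apply, this, hu0]
  have hperp : ∀ η ∈ Kᗮ, u η = 0 := fun η hη => by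
    simp [u, K.orthogonalProjectionOnto_apply_of_mem_orthogonal hη]
  have hker : ∀ η, η ∈ Kᗮ ↔ a η = 0 := fun η => by
    rw [hK, Submodule.orthogonal_closure, Submodule.mem_orthogonal]
    constructor
    · intro h
      rw [← inner_self_eq_zero (𝕜 := ℂ)]
      have := h (a (a η)) ⟨_, rfl⟩
      change inner ℂ (a (a η)) η = 0 at this
      nth_rw 1 [← hasa] at this
      rwa [ContinuousLinearMap.star_eq_adjoint, ContinuousLinearMap.adjoint_inner_left] at this
    · rintro h _ ⟨ξ, rfl⟩
      change inner ℂ (a ξ) η = 0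
      rw [← hasa, ContinuousLinearMap.star_eq_adjoint, ContinuousLinearMap.adjoint_inner_left, h,
        inner_zero_right]
  -- The difference `star u * u * a - a` is killed by `a`, so it takes values in `ker a = Kᗮ`, where
  -- `u` vanishes too. Its C⋆-square is therefore zero.
  have huu : star u * u * a = a := by
    have h1 : a * (star u * u * a) = a * a := by
      calc a * (star u * u * a) = star (u * a) * (u * a) := by
            rw [star_mul, hasa]; noncomm_ring
        _ = a * a := by rw [hua, ha, CFC.abs_mul_abs]
    have h2 : a * (star u * u * a - a) = 0 := by rw [mul_sub, h1, sub_self]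
    have h3 : u * (star u * u * a - a) = 0 := by
      ext ξ
      exact hperp _ ((hker _).2 (DFunLike.congr_fun h2 ξ))
    rw [← sub_eq_zero, ← CStarRing.star_mul_self_eq_zero_iff]
    calc star (star u * u * a - a) * (star u * u * a - a)
        = a * star u * (u * (star u * u * a - a)) - a * (star u * u * a - a) := by
          rw [star_sub, star_mul, star_mul, star_star, hasa]; noncomm_ring
      _ = 0 := by rw [h2, h3, mul_zero, sub_zero]
  have huuu : u * star u * u = u := by
    refine hext _ _ ?_ fun η hη => ?_
    · rw [mul_assoc, mul_assoc, ← mul_assoc (star u), huu]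
    · simp [hperp η hη]
  refine ⟨u, ?_, ?_, huuu, ?_, ?_⟩
  · refine M.mem_of_commute_commutant fun y hy => ?_
    have hay : a * y = y * a := by
      have h1 : Commute x y := commute_of_mem_commutant hx hy
      have h2 : Commute x (star y) := commute_of_mem_commutant hx (star_mem hy)
      exact (h1.cfcAbs_left h2).eq
    refine hext _ _ ?_ fun η hη => ?_
    · rw [mul_assoc, hua, mul_assoc, ← hay, ← mul_assoc, hua, commute_of_mem_commutant hx hy]
    · have : y η ∈ Kᗮ := by
        rw [hker] at hη ⊢
        rw [← mul_apply_eq_comp, hay, mul_apply_eq_comp, hη, map_zero]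
      simp [hperp η hη, hperp _ this]
  · rintro h
    exact hx0 (by rw [← hua, h, zero_mul])
  · intro r hr
    have har : a * r = a := by
      ext ξ
      rw [← sub_eq_zero, mul_apply_eq_comp, ← map_sub, ← norm_eq_zero, ha,
        norm_abs_apply, norm_eq_zero, map_sub, sub_eq_zero, ← mul_apply_eq_comp, hr]
    ext ξ
    rw [← sub_eq_zero, mul_apply_eq_comp, ← map_sub]
    refine hperp _ ((hker _).2 ?_)
    rw [map_sub, ← mul_apply_eq_comp, har, sub_self]
  · intro p hp
    refine hext _ _ (by rw [mul_assoc, hua, hp]) fun η hη => by simp [hperp η hη]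

end VonNeumannAlgebra


/-- Zorn's lemma in the form used for families of partial isometries: a new compatible member would
lie in the family already, hence be orthogonal to itself. -/
theorem exists_maximal_pairwise {α : Type*} (P : α → Prop) (R : α → α → Prop) :
    ∃ S : Set α, (∀ x ∈ S, P x) ∧ S.Pairwise R ∧
      ∀ y, P y → (∀ x ∈ S, R x y ∧ R y x) → y ∈ S := by
  obtain ⟨S, hS⟩ := zorn_subset {S : Set α | (∀ x ∈ S, P x) ∧ S.Pairwise R} (by
    intro c hc hchain
    refine ⟨⋃₀ c, ⟨?_, ?_⟩, fun s hs => Set.subset_sUnion_of_mem hs⟩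
    · rintro x ⟨s, hs, hx⟩
      exact (hc hs).1 x hx
    · exact (Set.pairwise_sUnion hchain.directedOn).2 fun s hs => (hc hs).2)
  refine ⟨S, hS.prop.1, hS.prop.2, fun y hy hR => ?_⟩
  have hins : insert y S ∈ {S : Set α | (∀ x ∈ S, P x) ∧ S.Pairwise R} := by
    refine ⟨?_, ?_⟩
    · rintro x (rfl | hx)
      · exact hy
      · exact hS.prop.1 x hx
    · exact hS.prop.2.insert fun x hx _ => (hR x hx).symm
  exact hS.le_of_ge hins (Set.subset_insert y S) (Set.mem_insert y S)

/-! ### Strong sums of orthogonal partial isometries -/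

section StrongSum

variable {H : Type*} [NormedAddCommGroup H] [InnerProductSpace ℂ H] {ι : Type*}

/-- `V` is the sum of the family `v` in the strong operator topology. -/
def IsStrongSum (v : ι → H →L[ℂ] H) (V : H →L[ℂ] H) : Prop :=
  ∀ ξ, HasSum (fun i => v i ξ) (V ξ)

namespace IsStrongSum

variable {v w : ι → H →L[ℂ] H} {V W : H →L[ℂ] H}

theorem mul_left (h : IsStrongSum v V) (q : H →L[ℂ] H) : IsStrongSum (fun i => q * v i) (q * V) :=
  fun ξ => q.hasSum (h ξ)

theorem mul_right (h : IsStrongSum v V) (q : H →L[ℂ] H) : IsStrongSum (fun i => v i * q) (V * q) :=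
  fun ξ => h (q ξ)

theorem unique (h : IsStrongSum v V) (h' : IsStrongSum w W) (hvw : ∀ i, v i = w i) : V = W := by
  obtain rfl : v = w := funext hvw
  ext ξ
  exact (h ξ).unique (h' ξ)

theorem eq_single (h : IsStrongSum v V) (j : ι) (hj : ∀ i ≠ j, v i = 0) : V = v j := by
  ext ξ
  exact (h ξ).unique (hasSum_single j fun i hi => by rw [hj i hi]; rfl)

end IsStrongSum

variable [CompleteSpace H]

/-- A family of partial isometries with pairwise orthogonal initial spaces and pairwise orthogonal
final spaces. -/
structure IsOrthogonalPartialIsometries (v : ι → H →L[ℂ] H) : Prop where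
  mul_star_mul_self : ∀ i, v i * star (v i) * v i = v i
  star_mul : ∀ i j, i ≠ j → star (v i) * v j = 0
  mul_star : ∀ i j, i ≠ j → v i * star (v j) = 0

namespace IsOrthogonalPartialIsometries

variable {v : ι → H →L[ℂ] H} {V : H →L[ℂ] H}

/-- The finite sum `T` is again a partial isometry, so the C⋆-identity gives `‖T‖⁴ = ‖T‖²`. -/
theorem norm_sum_le_one (h : IsOrthogonalPartialIsometries v) (s : Finset ι) :
    ‖∑ i ∈ s, v i‖ ≤ 1 := by
  set T := ∑ i ∈ s, v i with hT
  have h1 : ∀ i ∈ s, star T * v i = star (v i) * v i := fun i hi => by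
    rw [hT, star_sum, Finset.sum_mul, Finset.sum_eq_single_of_mem i hi
      fun j _ hji => h.star_mul j i hji]
  have h2 : ∀ i ∈ s, T * star (v i) = v i * star (v i) := fun i hi => by
    rw [hT, Finset.sum_mul, Finset.sum_eq_single_of_mem i hi fun j _ hji => h.mul_star j i hji]
  have h3 : T * star T * T = T := by
    conv_lhs => rw [mul_assoc]; enter [2, 2]; rw [hT]
    rw [Finset.mul_sum, Finset.sum_congr rfl h1, Finset.mul_sum]
    refine Finset.sum_congr rfl fun i hi => ?_
    rw [← mul_assoc, h2 i hi, h.mul_star_mul_self]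
  have h4 : ‖T‖ * ‖T‖ * (‖T‖ * ‖T‖) = ‖T‖ * ‖T‖ := by
    have h5 : star (star T * T) * (star T * T) = star T * T := by
      rw [StarMul.star_mul, star_star, mul_assoc, ← mul_assoc T, h3]
    rw [← CStarRing.norm_star_mul_self, ← CStarRing.norm_star_mul_self, h5]
  by_contra! hlt
  have h5 : 1 < ‖T‖ * ‖T‖ := by nlinarith
  nlinarith

theorem orthogonalFamily (h : IsOrthogonalPartialIsometries v) :
    OrthogonalFamily ℂ (fun i => LinearMap.range (v i : H →ₗ[ℂ] H))
      fun i => (LinearMap.range (v i : H →ₗ[ℂ] H)).subtypeₗᵢ := by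
  rintro i j hij ⟨_, ξ, rfl⟩ ⟨_, η, rfl⟩
  change inner ℂ (v i ξ) (v j η) = 0
  rw [← ContinuousLinearMap.adjoint_inner_right, ← ContinuousLinearMap.star_eq_adjoint,
    ← mul_apply_eq_comp, h.star_mul i j hij]
  simp

/-- Pythagoras turns the uniform bound on finite sums into a Bessel inequality. -/
theorem summable_apply (h : IsOrthogonalPartialIsometries v) (ξ : H) :
    Summable fun i => v i ξ := by
  refine (h.orthogonalFamily.summable_iff_norm_sq_summable
    fun i => ⟨v i ξ, LinearMap.mem_range_self (v i : H →ₗ[ℂ] H) ξ⟩).2 ?_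
  refine summable_of_sum_le (c := ‖ξ‖ ^ 2) (fun i => by positivity) fun s => ?_
  rw [← h.orthogonalFamily.norm_sum]
  have : ‖(∑ i ∈ s, v i) ξ‖ ≤ ‖ξ‖ := by
    simpa using (∑ i ∈ s, v i).le_of_opNorm_le (h.norm_sum_le_one s) ξ
  rw [_root_.sum_apply] at this
  exact pow_le_pow_left₀ (norm_nonneg _) this 2

theorem exists_isStrongSum (h : IsOrthogonalPartialIsometries v) (M : VonNeumannAlgebra H)
    (hv : ∀ i, v i ∈ M) : ∃ V ∈ M, IsStrongSum v V := by
  let T : H →ₗ[ℂ] H :=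
    { toFun := fun ξ => ∑' i, v i ξ
      map_add' := fun ξ η => by
        simp_rw [map_add]
        exact (h.summable_apply ξ).tsum_add (h.summable_apply η)
      map_smul' := fun c ξ => by
        simp_rw [map_smul]
        exact (h.summable_apply ξ).tsum_const_smul c }
  let V : H →L[ℂ] H := T.mkContinuous 1 fun ξ => by
    refine le_of_tendsto (h.summable_apply ξ).hasSum.norm (Filter.Eventually.of_forall fun s => ?_)
    rw [← _root_.sum_apply]
    exact (∑ i ∈ s, v i).le_of_opNorm_le (h.norm_sum_le_one s) ξ
  have hV : IsStrongSum v V := fun ξ => (h.summable_apply ξ).hasSum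
  refine ⟨V, M.mem_of_commute_commutant fun y hy => ?_, hV⟩
  exact (hV.mul_left y).unique (hV.mul_right y) fun i =>
    (VonNeumannAlgebra.commute_of_mem_commutant (hv i) hy).symm

theorem strongSum_mul_star (h : IsOrthogonalPartialIsometries v) (hV : IsStrongSum v V) (j : ι) :
    V * star (v j) = v j * star (v j) :=
  (hV.mul_right (star (v j))).eq_single j fun i hi => h.mul_star i j hi

theorem star_mul_strongSum (h : IsOrthogonalPartialIsometries v) (hV : IsStrongSum v V) (j : ι) :
    star (v j) * V = star (v j) * v j :=
  (hV.mul_left (star (v j))).eq_single j fun i hi => h.star_mul j i hi.symm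

theorem mul_star_strongSum_mul_strongSum (h : IsOrthogonalPartialIsometries v)
    (hV : IsStrongSum v V) (j : ι) : v j * (star V * V) = v j := by
  have := congrArg star (h.strongSum_mul_star hV j)
  rw [StarMul.star_mul, StarMul.star_mul, star_star] at this
  rw [← mul_assoc, this, mul_assoc, h.star_mul_strongSum hV, ← mul_assoc, h.mul_star_mul_self]

theorem strongSum_mul_star_mul_self (h : IsOrthogonalPartialIsometries v)
    (hV : IsStrongSum v V) : V * star V * V = V := by
  rw [mul_assoc]
  exact (hV.mul_right (star V * V)).unique hV fun j => h.mul_star_strongSum_mul_strongSum hV j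

end IsOrthogonalPartialIsometries

end StrongSum

theorem mul_eq_self_of_star_mul_self_eq {A : Type*} [CStarAlgebra A] {v e : A}
    (he : IsStarProjection e) (hv : star v * v = e) : v * e = v := by
  have h1 := he.isIdempotentElem.eq
  rw [← sub_eq_zero, ← CStarRing.star_mul_self_eq_zero_iff, star_sub, star_mul,
    he.isSelfAdjoint.star_eq]
  calc (e * star v - star v) * (v * e - v)
      = e * (star v * v) * e - e * (star v * v) - (star v * v) * e + star v * v := by noncomm_ring
    _ = 0 := by rw [hv, h1, h1]; simp

/-! ### Finite projections -/

namespace VonNeumannAlgebra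

variable {H : Type*} [NormedAddCommGroup H] [InnerProductSpace ℂ H] [CompleteSpace H]

/-- A finite projection does not dominate infinitely many orthogonal copies of a nonzero
projection. -/
theorem IsFiniteProj.false_of_sequence {M : VonNeumannAlgebra H} {E e : H →L[ℂ] H}
    (hE : M.IsFiniteProj E) (he : IsStarProjection e) (he0 : e ≠ 0)
    (v : ℕ → H →L[ℂ] H) (hvM : ∀ k, v k ∈ M) (hv : ∀ k, star (v k) * v k = e)
    (hvv : ∀ j k, j ≠ k → star (v j) * v k = 0) (hEv : ∀ k, E * v k = v k) : False := by
  have hEs := hE.1.2.isSelfAdjoint.star_eq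
  have hEi := hE.1.2.isIdempotentElem.eq
  have hve : ∀ k, v k * e = v k := fun k => mul_eq_self_of_star_mul_self_eq he (hv k)
  have hvE : ∀ k, star (v k) * E = star (v k) := fun k => by
    simpa [hEs] using congrArg star (hEv k)
  -- `w k` carries the `k`-th copy of `e` to the next one; the strong sum `W` is a unilateral shift.
  let w : ℕ → H →L[ℂ] H := fun k => v (k + 1) * star (v k)
  have hsw : ∀ k, star (w k) = v k * star (v (k + 1)) := fun k => by simp [w]
  have hw : IsOrthogonalPartialIsometries w := by
    refine ⟨fun k => ?_, fun j k hjk => ?_, fun j k hjk => ?_⟩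
    · rw [hsw]
      calc v (k + 1) * star (v k) * (v k * star (v (k + 1))) * (v (k + 1) * star (v k))
          = v (k + 1) * (star (v k) * v k) * (star (v (k + 1)) * v (k + 1)) * star (v k) := by
            noncomm_ring
        _ = w k := by rw [hv, hv, hve, hve]
    · rw [hsw]
      calc v j * star (v (j + 1)) * (v (k + 1) * star (v k))
          = v j * (star (v (j + 1)) * v (k + 1)) * star (v k) := by noncomm_ring
        _ = 0 := by rw [hvv _ _ (by omega)]; simp
    · rw [hsw]
      calc v (j + 1) * star (v j) * (v k * star (v (k + 1)))
          = v (j + 1) * (star (v j) * v k) * star (v (k + 1)) := by noncomm_ring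
        _ = 0 := by rw [hvv _ _ hjk]; simp
  obtain ⟨W, hWM, hW⟩ := hw.exists_isStrongSum M fun k => mul_mem (hvM _) (star_mem (hvM _))
  have hEW : E * W = W := (hW.mul_left E).unique hW fun k => by
    simp only [w]; rw [← mul_assoc, hEv]
  have hWE : W * E = W := (hW.mul_right E).unique hW fun k => by
    simp only [w]; rw [mul_assoc, hvE]
  have hWsE : E * star W = star W := by simpa [hEs] using congrArg star hWE
  set P := star W * W with hP
  have hPs : star P = P := by rw [hP, star_mul, star_star]
  have hPw : ∀ k, P * star (w k) = star (w k) := fun k => by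
    have := congrArg star (hw.mul_star_strongSum_mul_strongSum hW k)
    rwa [star_mul, hPs] at this
  have hPv : ∀ k, P * v k = v k := fun k => by
    have : v k = star (w k) * v (k + 1) := by rw [hsw, mul_assoc, hv, hve]
    rw [this, ← mul_assoc, hPw]
  have hPW : P * W = W := (hW.mul_left P).unique hW fun k => by
    simp only [w]; rw [← mul_assoc, hPv]
  have hWP : W * P = W := by
    rw [hP, ← mul_assoc]; exact hw.strongSum_mul_star_mul_self hW
  have hWsP : star W * P = star W := by simpa [hPs] using congrArg star hPW
  have hEP : E * P = P := by rw [hP, ← mul_assoc, hWsE]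
  have hPE : P * E = P := by rw [hP, mul_assoc, hWE]
  have hPP : P * P = P := by rw [hP, mul_assoc, ← hP, hWP]
  have hstar : star (W + (E - P)) = star W + (E - P) := by
    rw [star_add, star_sub, hEs, hPs]
  have hWsE' : star W * E = star W := by simpa [hEs] using congrArg star hEW
  have hVV : (W + (E - P)) * star (W + (E - P)) = W * star W + (E - P) := by
    have hPWs : P * star W = star W := by rw [← hPs, ← star_mul, hWP]
    rw [hstar]
    calc (W + (E - P)) * (star W + (E - P))
        = W * star W + (W * E - W * P) + (E * star W - P * star W) +
          (E * E - E * P - P * E + P * P) := by noncomm_ring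
      _ = _ := by rw [hWE, hWP, hWsE, hPWs, hEi, hEP, hPE, hPP]; abel
  -- Completed by the identity on `E - P`, the shift is an isometry of `E` whose range misses the
  -- copy given by `v 0`.
  have hfin := hE.2 (W + (E - P))
    (add_mem hWM (sub_mem hE.1.1 (mul_mem (star_mem hWM) hWM))) ?_ ?_
  · rw [hVV] at hfin
    have hWW : W * star W = P := by
      have : W * star W + (E - P) - (E - P) = E - (E - P) := by rw [hfin]
      simpa using this
    have h0 : star (v 0) * W = 0 := by
      rw [show star (v 0) * W = (0 : H →L[ℂ] H) * W from
        (hW.mul_left (star (v 0))).unique (hW.mul_left 0) fun k => by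
          simp only [w]; rw [← mul_assoc, hvv _ _ (by omega), zero_mul,
            zero_mul], zero_mul]
    have h1 : star (v 0) * P = star (v 0) := by simpa [hPs] using congrArg star (hPv 0)
    rw [← hWW, ← mul_assoc, h0, zero_mul] at h1
    apply he0
    rw [← hv 0, ← h1, zero_mul]
  · rw [hstar]
    calc (star W + (E - P)) * (W + (E - P))
        = star W * W + (star W * E - star W * P) + (E * W - P * W) +
          (E * E - E * P - P * E + P * P) := by noncomm_ring
      _ = E := by rw [hWsE', hWsP, hEW, hPW, hEi, hEP, hPE, hPP, ← hP]; abel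
  · rw [hVV, mul_add, ← mul_assoc, hEW, mul_sub, hEi, hEP]

end VonNeumannAlgebra

/-! ### Comparison with an abelian projection -/

namespace VonNeumannAlgebra

variable {H : Type*} [NormedAddCommGroup H] [InnerProductSpace ℂ H] [CompleteSpace H]

/-- If the projection `f` is nowhere orthogonal to the abelian projection `e`, then `e` is
equivalent to a subprojection of `f`. -/
theorem IsAbelianProj.exists_star_mul_self_eq {M : VonNeumannAlgebra H} {e f : H →L[ℂ] H}
    (he : M.IsAbelianProj e) (hf : M.IsProj f)
    (h : ∀ r, M.IsProj r → e * r = r → r ≠ 0 → ∃ m ∈ M, f * m * r ≠ 0) :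
    ∃ V ∈ M, star V * V = e ∧ f * V = V := by
  have hei := he.1.2.isIdempotentElem.eq
  have hes := he.1.2.isSelfAdjoint.star_eq
  have hfi := hf.2.isIdempotentElem.eq
  -- Requiring `u * m * star w = 0` for every `m ∈ M`, not only `m = 1`, makes the final spaces
  -- orthogonal as well as the initial ones.
  obtain ⟨S, hS, hSR, hmax⟩ := exists_maximal_pairwise
    (fun u : H →L[ℂ] H => u ∈ M ∧ u * star u * u = u ∧ u * e = u ∧ f * u = u)
    (fun u w => ∀ m ∈ M, u * m * star w = 0)
  have hR : ∀ u w : S, u ≠ w → ∀ m ∈ M, (u : H →L[ℂ] H) * m * star (w : H →L[ℂ] H) = 0 :=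
    fun u w huw => hSR u.2 w.2 fun h => huw (Subtype.ext h)
  have hv : IsOrthogonalPartialIsometries (fun u : S => (u : H →L[ℂ] H)) := by
    refine ⟨fun u => (hS u u.2).2.1, fun u w huw => ?_, fun u w huw => ?_⟩
    · obtain ⟨u, hu⟩ := u
      obtain ⟨w, hw⟩ := w
      have h1 := hR _ _ huw (star u * w) (mul_mem (star_mem (hS u hu).1) (hS w hw).1)
      have h2 : star u * u * star u = star u := by
        simpa [mul_assoc] using congrArg star (hS u hu).2.1
      calc star u * w = (star u * u * star u) * (w * star w * w) := by
            rw [h2, (hS w hw).2.1]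
        _ = star u * (u * (star u * w) * star w) * w := by noncomm_ring
        _ = 0 := by
          rw [h1]; simp
    · simpa using hR u w huw 1 (one_mem M)
  obtain ⟨V, hVM, hV⟩ := hv.exists_isStrongSum M fun u => (hS u u.2).1
  have hVe : V * e = V := (hV.mul_right e).unique hV fun u => (hS u u.2).2.2.1
  have hfV : f * V = V := (hV.mul_left f).unique hV fun u => (hS u u.2).2.2.2
  have heV : e * star V = star V := by simpa [hes] using congrArg star hVe
  refine ⟨V, hVM, ?_, hfV⟩
  set q := star V * V with hq
  have hqs : star q = q := by rw [hq, star_mul, star_star]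
  have hqe : q * e = q := by rw [hq, mul_assoc, hVe]
  have heq : e * q = q := by rw [hq, ← mul_assoc, heV]
  have hqq : q * q = q := by
    rw [hq, mul_assoc, ← mul_assoc V, hv.strongSum_mul_star_mul_self hV]
  by_contra hne
  have hr0 : e - q ≠ 0 := fun h0 => hne (sub_eq_zero.1 h0).symm
  have her : e * (e - q) = e - q := by rw [mul_sub, hei, heq]
  have hre : (e - q) * e = e - q := by rw [sub_mul, hei, hqe]
  have hrM : e - q ∈ M := sub_mem he.1.1 (mul_mem (star_mem hVM) hVM)
  have hrs : star (e - q) = e - q := by rw [star_sub, hes, hqs]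
  have hri : (e - q) * (e - q) = e - q := by
    rw [mul_sub, hre, sub_mul, heq, hqq, sub_self, sub_zero]
  obtain ⟨m, hm, hm0⟩ := h (e - q) ⟨hrM, hri, hrs⟩ her hr0
  obtain ⟨u, huM, hu0, huu, hur, huf⟩ :=
    M.exists_partialIsometry (mul_mem (mul_mem hf.1 hm) hrM) hm0
  have hur' : u * (e - q) = u := hur _ (by rw [mul_assoc, hri])
  have huf' : f * u = u := huf _ (by rw [← mul_assoc, ← mul_assoc, hfi])
  have hru : (e - q) * star u = star u := by simpa only [star_mul, hrs] using congrArg star hur'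
  have hwr : ∀ w ∈ S, w * (e - q) = 0 := fun w hw => by
    have : w * q = w := hv.mul_star_strongSum_mul_strongSum hV ⟨w, hw⟩
    rw [mul_sub, (hS w hw).2.2.1, this, sub_self]
  -- As `e M e` is commutative, `star w * w` moves past `e * m * e` to meet `e - q`, which `w`
  -- kills.
  have hwu : ∀ w ∈ S, ∀ m ∈ M, w * m * star u = 0 := fun w hw m hm => by
    obtain ⟨hwM, hww, hwe, -⟩ := hS w hw
    have hew : e * star w = star w := by simpa [hes] using congrArg star hwe
    have hcomm := he.2 (star w * w) (mul_mem (star_mem hwM) hwM) m hm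
    calc w * m * star u
        = (w * star w * w * e) * m * (e * (e - q) * star u) := by rw [her, hru, hww, hwe]
      _ = w * ((e * star w) * (w * e) * m * e) * (e - q) * star u := by
          rw [hew]; noncomm_ring
      _ = w * ((e * (star w * w) * e) * (e * m * e)) * (e - q) * star u := by
          rw [show (e * (star w * w) * e) * (e * m * e) = e * (star w * w) * (e * e) * m * e by
            noncomm_ring, hei]
          noncomm_ring
      _ = w * (e * m * e) * (e * (star w * w)) * (e * (e - q)) * star u := by
          rw [hcomm]; noncomm_ring
      _ = w * (e * m * e) * e * star w * (w * (e - q)) * star u := by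
          rw [her]; noncomm_ring
      _ = 0 := by rw [hwr w hw]; simp
  have huS : u ∈ S := by
    refine hmax u ⟨huM, huu, ?_, huf'⟩ fun w hw => ⟨hwu w hw, fun m hm => ?_⟩
    · rw [← hur', mul_assoc, hre]
    · have := congrArg star (hwu w hw (star m) (star_mem hm))
      simpa [mul_assoc] using this
  exact hu0 (by rw [← hur', hwr u huS])

/-- Below a finite central projection `E`, an abelian projection `e` generates a nonzero direct
summand as a finitely generated module. -/
theorem IsAbelianProj.exists_finset_sum_mul {M : VonNeumannAlgebra H} {E e : H →L[ℂ] H}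
    (he : M.IsAbelianProj e) (he0 : e ≠ 0) (hE : M.IsFiniteProj E) (hEc : E ∈ M.commutant)
    (hEe : E * e = e) :
    ∃ (s : Finset (H →L[ℂ] H)) (r : H →L[ℂ] H), (∀ v ∈ s, v ∈ M ∧ v * e = v) ∧ M.IsProj r ∧
      e * r = r ∧ r ≠ 0 ∧ ∀ m ∈ M, (∑ v ∈ s, v * star v) * m * r = m * r := by
  obtain ⟨S, hS, hSR, hmax⟩ := exists_maximal_pairwise
    (fun v : H →L[ℂ] H => v ∈ M ∧ star v * v = e ∧ E * v = v) (fun v w => star v * w = 0)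
  have hEs := hE.1.2.isSelfAdjoint.star_eq
  have hEi := hE.1.2.isIdempotentElem.eq
  have hve : ∀ v ∈ S, v * e = v := fun v hv =>
    mul_eq_self_of_star_mul_self_eq he.1.2 (hS v hv).2.1
  have hfin : S.Finite := by
    by_contra hinf
    let f := Set.Infinite.natEmbedding S hinf
    refine hE.false_of_sequence he.1.2 he0 (fun k => f k) (fun k => (hS _ (f k).2).1)
      (fun k => (hS _ (f k).2).2.1) (fun j k hjk => hSR (f j).2 (f k).2 fun h => hjk ?_)
      (fun k => (hS _ (f k).2).2.2)
    exact f.injective (Subtype.ext h)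
  by_contra! hcon
  set p := ∑ v ∈ hfin.toFinset, v * star v with hp
  have hpM : p ∈ M := sum_mem fun v hv => by
    have := (hS v (hfin.mem_toFinset.1 hv)).1
    exact mul_mem this (star_mem this)
  have hps : star p = p := by
    rw [hp, star_sum]
    exact Finset.sum_congr rfl fun v _ => by rw [star_mul, star_star]
  have hpv : ∀ v ∈ S, p * v = v := fun v hv => by
    rw [hp, Finset.sum_mul, Finset.sum_eq_single_of_mem v (hfin.mem_toFinset.2 hv)
      fun w hw hwv => by rw [mul_assoc, hSR (hfin.mem_toFinset.1 hw) hv hwv, mul_zero],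
      mul_assoc, (hS v hv).2.1, hve v hv]
  have hpp : p * p = p := by
    conv_lhs => enter [2]; rw [hp]
    rw [Finset.mul_sum]
    exact Finset.sum_congr rfl fun v hv => by
      rw [← mul_assoc, hpv v (hfin.mem_toFinset.1 hv)]
  have hEp : E * p = p := by
    rw [hp, Finset.mul_sum]
    exact Finset.sum_congr rfl fun v hv => by
      rw [← mul_assoc, (hS v (hfin.mem_toFinset.1 hv)).2.2]
  have hpE : p * E = p := by simpa [hEs, hps] using congrArg star hEp
  have hfs : star (E - p) = E - p := by rw [star_sub, hEs, hps]
  -- If no `r` works, `E - p` is nowhere orthogonal to `e` and contains a further copy of it.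
  obtain ⟨V, hVM, hV, hfV⟩ := he.exists_star_mul_self_eq (f := E - p)
    ⟨sub_mem hE.1.1 hpM, by
      rw [IsIdempotentElem, mul_sub, sub_mul, sub_mul, hEi, hpE, hEp, hpp, sub_self, sub_zero],
      hfs⟩ fun r hr her hr0 => by
    obtain ⟨m, hm, hne⟩ := hcon hfin.toFinset r
      (fun v hv => ⟨(hS v (hfin.mem_toFinset.1 hv)).1, hve v (hfin.mem_toFinset.1 hv)⟩) hr her hr0
    refine ⟨m, hm, fun h0 => hne ?_⟩
    rw [sub_mul, sub_mul, sub_eq_zero] at h0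
    have hEr : E * r = r := by rw [← her, ← mul_assoc, hEe]
    rw [← h0, ← commute_of_mem_commutant hm hEc, mul_assoc, hEr]
  have hfv : ∀ v ∈ S, (E - p) * v = 0 := fun v hv => by
    rw [sub_mul, (hS v hv).2.2, hpv v hv, sub_self]
  have hvV : ∀ v ∈ S, star v * V = 0 := fun v hv => by
    have h1 : star v * (E - p) = 0 := by simpa [hEs, hps] using congrArg star (hfv v hv)
    rw [← hfV, ← mul_assoc, h1, zero_mul]
  have hVS : V ∈ S := by
    refine hmax V ⟨hVM, hV, ?_⟩ fun v hv => ⟨hvV v hv, ?_⟩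
    · rw [← hfV, ← mul_assoc, mul_sub, hEi, hEp]
    · simpa using congrArg star (hvV v hv)
  apply he0
  rw [← hV, ← hfV, hfv V hVS, mul_zero]

end VonNeumannAlgebra

/-! ### Nilpotents in matrices over a commutative reduced ring -/

/-- The lower coefficients of the characteristic polynomial are nilpotent, hence zero; conclude by
Cayley–Hamilton. -/
theorem Matrix.pow_card_eq_zero_of_isNilpotent {R n : Type*} [CommRing R] [IsReduced R] [Fintype n]
    [DecidableEq n] {A : Matrix n n R} (hA : IsNilpotent A) : A ^ Fintype.card n = 0 := by
  have h : A.charpoly - Polynomial.X ^ Fintype.card n = 0 := by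
    ext i
    exact (Polynomial.isNilpotent_iff.1
      (Matrix.isNilpotent_charpoly_sub_pow_of_isNilpotent hA) i).eq_zero
  have := Matrix.aeval_self_charpoly A
  rw [sub_eq_zero.1 h] at this
  simpa using this

open scoped IsMulCommutative in
-- Every element is normal, and a normal element of square zero vanishes by the C⋆-identity.
theorem StarSubalgebra.isReduced_of_isMulCommutative {A : Type*} [CStarAlgebra A]
    (S : StarSubalgebra ℂ A) [IsMulCommutative S] : IsReduced S := by
  rw [isReduced_iff_pow_one_lt 2 one_lt_two]
  intro a ha
  have hcomm : (a : A) * star (a : A) = star (a : A) * a :=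
    congrArg Subtype.val (mul_comm a (star a))
  have ha' : (a : A) * a = 0 := by
    have := congrArg Subtype.val ha
    rwa [pow_two] at this
  have h : star (a : A) * a = 0 := by
    rw [← CStarRing.star_mul_self_eq_zero_iff, star_mul, star_star]
    calc star (a : A) * a * (star (a : A) * a) = star (a : A) * (a * star (a : A)) * a := by
          noncomm_ring
      _ = star (a : A) * star (a : A) * (a * a) := by rw [hcomm]; noncomm_ring
      _ = 0 := by rw [ha', mul_zero]
  exact Subtype.ext ((CStarRing.star_mul_self_eq_zero_iff _).1 h)

namespace VonNeumannAlgebra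

variable {H : Type*} [NormedAddCommGroup H] [InnerProductSpace ℂ H] [CompleteSpace H]

open scoped IsMulCommutative in
/-- Where an abelian projection generates a finitely generated module, the nilpotent elements have
bounded order. -/
theorem IsAbelianProj.pow_mul_mul_eq_zero {M : VonNeumannAlgebra H} {e r : H →L[ℂ] H}
    (he : M.IsAbelianProj e) (s : Finset (H →L[ℂ] H)) (hs : ∀ v ∈ s, v ∈ M ∧ v * e = v)
    (hr : M.IsProj r) (her : e * r = r)
    (hsum : ∀ m ∈ M, (∑ v ∈ s, v * star v) * m * r = m * r) {x : H →L[ℂ] H} (hx : x ∈ M)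
    (hnil : IsNilpotent x) : ∀ m ∈ M, x ^ (s.card + 1) * m * r = 0 := by
  classical
  have hei := he.1.2.isIdempotentElem.eq
  have hes := he.1.2.isSelfAdjoint.star_eq
  have hri := hr.2.isIdempotentElem.eq
  have hre : r * e = r := by
    simpa [hes, hr.2.isSelfAdjoint.star_eq] using congrArg star her
  -- The corner `e M e` has unit `e`; adjoining the unit of `B(H)` gives a commutative star
  -- subalgebra over which matrices can be formed.
  let C : Set (H →L[ℂ] H) := {y | ∃ m ∈ M, e * m * e = y}
  have hC : IsMulCommutative (StarAlgebra.adjoin ℂ C) := by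
    refine StarAlgebra.isMulCommutative_adjoin ℂ ?_ ?_
    · rintro _ ⟨m, hm, rfl⟩ _ ⟨k, hk, rfl⟩
      exact he.2 m hm k hk
    · rintro _ ⟨m, hm, rfl⟩ _ ⟨k, hk, rfl⟩
      have : star (e * k * e) = e * star k * e := by simp [hes, mul_assoc]
      rw [this]
      exact he.2 m hm _ (star_mem hk)
  have := StarSubalgebra.isReduced_of_isMulCommutative (StarAlgebra.adjoin ℂ C)
  have hmem : ∀ (y : M) (v w : s),
      r * star (v : H →L[ℂ] H) * y * w * r ∈ StarAlgebra.adjoin ℂ C := by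
    rintro y ⟨v, hv⟩ ⟨w, hw⟩
    refine StarAlgebra.subset_adjoin ℂ C ⟨r * star v * y * w * r, ?_, ?_⟩
    · exact mul_mem (mul_mem (mul_mem (mul_mem hr.1 (star_mem (hs v hv).1)) y.2) (hs w hw).1) hr.1
    · rw [← mul_assoc, ← mul_assoc, ← mul_assoc, ← mul_assoc, her, mul_assoc _ r e, hre]
  let φ : M → Matrix s s (StarAlgebra.adjoin ℂ C) := fun y => Matrix.of fun v w =>
    ⟨r * star (v : H →L[ℂ] H) * y * w * r, hmem y v w⟩
  -- `r` lies in the commutative corner `e M e`, so it can be moved across `star v * m`.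
  have hrcomm : ∀ v ∈ s, ∀ m ∈ M, r * (star v * m * r) = star v * m * r := by
    intro v hv m hm
    have hev : e * star v = star v := by simpa [hes] using congrArg star (hs v hv).2
    have hcomm := he.2 r hr.1 (star v * m) (mul_mem (star_mem (hs v hv).1) hm)
    calc r * (star v * m * r) = (e * r * e) * (e * (star v * m) * e) * r := by
          rw [her, hre, show r * (e * (star v * m) * e) * r = r * (e * star v) * m * (e * r) by
            noncomm_ring, her, hev]
          noncomm_ring
      _ = e * star v * m * (e * (e * r * e) * r) := by rw [hcomm]; noncomm_ring
      _ = star v * m * r := by rw [hev, her, hre, her, hri]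
  have hmul : ∀ y z : M, φ (y * z) = φ y * φ z := by
    intro y z
    refine Matrix.ext fun ⟨v, hv⟩ ⟨w, hw⟩ => Subtype.ext ?_
    rw [Matrix.mul_apply, AddSubmonoidClass.coe_finsetSum]
    have hterm : ∀ u ∈ s, r * star v * y * u * r * (r * star u * z * w * r) =
        r * star v * y * (u * star u * (z * w) * r) := fun u hu => by
      have h1 := hrcomm u hu (z * w) (mul_mem z.2 (hs w hw).1)
      calc r * star v * y * u * r * (r * star u * z * w * r)
          = r * star v * y * u * (r * r * (star u * (z * w) * r)) := by noncomm_ring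
        _ = r * star v * y * (u * star u * (z * w) * r) := by rw [hri, h1]; noncomm_ring
    have hzw := hsum (z * w) (mul_mem z.2 (hs w hw).1)
    rw [Finset.sum_mul, Finset.sum_mul] at hzw
    calc r * star v * (y * z : H →L[ℂ] H) * w * r
        = r * star v * y * (z * w * r) := by noncomm_ring
      _ = ∑ u ∈ s, r * star v * y * u * r * (r * star u * z * w * r) := by
          rw [Finset.sum_congr rfl hterm, ← Finset.mul_sum, hzw]
      _ = _ := (Finset.sum_coe_sort s
          fun u => r * star v * y * u * r * (r * star u * z * w * r)).symm
  -- `φ` need not preserve the unit, so only positive powers are compared; hence the exponent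
  -- `s.card + 1`, which also covers empty `s`.
  have hpow : ∀ (y : M) (k : ℕ), φ (y ^ (k + 1)) = φ y ^ (k + 1) := by
    intro y k
    induction k with
    | zero => simp
    | succ k ih => rw [pow_succ, hmul, ih, ← pow_succ]
  set y : M := ⟨x, hx⟩ ^ (s.card + 1) with hy
  have hφ : φ y = 0 := by
    obtain ⟨k, hk⟩ := hnil
    have hn : IsNilpotent (φ ⟨x, hx⟩) := by
      refine ⟨k + 1, ?_⟩
      rw [← hpow, show (⟨x, hx⟩ : M) ^ (k + 1) = 0 from
        Subtype.ext (by simp [pow_succ, hk])]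
      ext v w
      simp [φ]
    have := Matrix.pow_card_eq_zero_of_isNilpotent hn
    rw [Fintype.card_coe] at this
    rw [hy, hpow, pow_succ, this, zero_mul]
  -- Inserting `∑ v v*` on the left and then on the right recovers `y * m * r = 0` from the
  -- vanishing of all matrix entries.
  have hentry : ∀ v ∈ s, ∀ w ∈ s, star v * (y * w) * r = 0 := fun v hv w hw => by
    rw [← hrcomm v hv _ (mul_mem y.2 (hs w hw).1)]
    have h0 : r * star v * y * w * r = 0 :=
      congrArg Subtype.val (congrFun (congrFun hφ ⟨v, hv⟩) ⟨w, hw⟩)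
    rw [← h0]
    noncomm_ring
  have hcol : ∀ w ∈ s, y * w * r = 0 := fun w hw => by
    rw [← hsum _ (mul_mem y.2 (hs w hw).1), Finset.sum_mul, Finset.sum_mul]
    exact Finset.sum_eq_zero fun v hv => by
      rw [mul_assoc, mul_assoc, ← mul_assoc (star v), hentry v hv w hw, mul_zero]
  intro m hm
  calc x ^ (s.card + 1) * m * r = y * (m * r) := by rw [mul_assoc]; rfl
    _ = ∑ w ∈ s, y * w * r * (star w * m * r) := by
        rw [← hsum m hm, Finset.sum_mul, Finset.sum_mul, Finset.mul_sum]
        refine Finset.sum_congr rfl fun w hw => ?_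
        conv_rhs => rw [mul_assoc, hrcomm w hw m hm]
        noncomm_ring
    _ = 0 := Finset.sum_eq_zero fun w hw => by rw [hcol w hw, zero_mul]

end VonNeumannAlgebra

/-! ### The contradiction -/

theorem lemma6p6 {B H : Type*} [CStarAlgebra B] [TopologicalSpace.SeparableSpace B]
    [NormedAddCommGroup H] [InnerProductSpace ℂ H] [CompleteSpace H]
    (hsimple : IsSimpleCStarAlgebra B) (hinf : ¬ FiniteDimensional ℂ B)
    (π : B →⋆ₐ[ℂ] (H →L[ℂ] H)) :
    ¬ (bicommutant π).ContainsTypeIFin := by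
  rintro ⟨E, hE0, hEI, hEfin⟩
  have hEi := hEfin.1.2.isIdempotentElem.eq
  obtain ⟨e, he, hEe, he0⟩ := hEI.2 E hEI.1 hEi hE0
  obtain ⟨s, r, hs, hr, her, hr0, hsum⟩ :=
    he.exists_finset_sum_mul he0 hEfin hEI.1.2 hEe
  have hπ : ∀ b, π b ∈ bicommutant π := fun b => by
    rw [← SetLike.mem_coe, coe_bicommutant]
    exact Set.subset_centralizer_centralizer ⟨b, rfl⟩
  obtain ⟨x, hxn, hx0⟩ := hsimple.exists_isNilpotent_pow_ne_zero hinf (s.card + 1)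
  have hcont : Continuous π := by
    open scoped CStarAlgebra in exact map_continuous π
  -- The annihilator of `M r` in `B` is an ideal because `π d * m` stays in `M`, and it is proper
  -- because `r ≠ 0`.
  refine hx0 (hsimple.mem_of_isClosed_ideal
    {b | ∀ m ∈ bicommutant π, π b * m * r = 0} ?_ ?_ ?_ ?_ ?_ _ ?_)
  · simp only [Set.ofPred_forall]
    exact isClosed_iInter fun m => isClosed_iInter fun _ =>
      isClosed_eq (by fun_prop) continuous_const
  · intro m _
    simp
  · intro a ha b hb m hm
    rw [map_add, add_mul, add_mul, ha m hm, hb m hm, add_zero]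
  · intro b hb c d m hm
    have := hb (π d * m) (mul_mem (hπ d) hm)
    rw [map_mul, map_mul, show π c * π b * π d * m * r = π c * (π b * (π d * m) * r) by
      noncomm_ring, this, mul_zero]
  · intro h1
    exact hr0 (by simpa using h1 1 (one_mem _))
  · intro m hm
    rw [map_pow]
    exact he.pow_mul_mul_eq_zero s hs hr her hsum (hπ x) (hxn.map π) m hm
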